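/- A \emph{smooth quasiloopoid} $G\rightrightarrows M$ consists of (finite-dimensional, Hausdorff, second countable) smooth manifolds $G$ and $M$, with $M\subset G$ a submanifold (the units), surjective submersions $\alpha,\beta:G\to M$, and a smooth partial multiplication $m:G^{(2)}\to G$, $m(g,h)=gh$, defined exactly on $G^{(2)}=\{(g,h)\in G\times G \mid \beta(g)=\alpha(h)\}$, such that $g\,\beta(g)=g$ and $\alpha(h)\,h=h$ for all $g,h\in G$ (in particular these products are defined, so $\alpha|_M=\beta|_M=\mathrm{id}_M$), and such that the translations $l_g:\alpha^{-1}(\beta(g))\to G$, $l_g(h)=gh$, and $r_h:\beta^{-1}(\alpha(h))\to G$, $r_h(g)=gh$, are injective immersions. No associativity is assumed. Let $AG=\nu(G,M)=TG|_M/TM$ be the normal bundle of $M$ in $G$. For $x\in A_aG$, $a\in M$, let $\bar x^{\alpha}\in\ker T_a\alpha$ and $\bar x^{\beta}\in\ker T_a\beta$ be the unique representatives of $x$ in $T_aG$ tangent to the $\alpha$-fibre and to the $\beta$-fibre, respectively. For a smooth section $X$ of $AG$ define its left and right prolongations by $$\overset{\leftarrow}{X}(g)=(T_{\beta(g)}l_g)\big(\bar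 X^{\alpha}(\beta(g))\big),\qquad \overset{\rightarrow}{X}(g)=(T_{\alpha(g)}r_g)\big(\bar X^{\beta}(\alpha(g))\big),\qquad g\in G .$$ \textbf{Theorem.} Let $G\rightrightarrows M$ be a smooth quasiloopoid. For every smooth section $X$ of $AG$ the vector fields $\overset{\leftarrow}{X}$ and $\overset{\rightarrow}{X}$ are smooth on $G$. For smooth sections $X,Y$ of $AG$ and $a\in M$ let $[X,Y]_l(a)$ and $[X,Y]_r(a)$ be the classes in $A_aG=T_aG/T_aM$ of $[\overset{\leftarrow}{X},\overset{\leftarrow}{Y}](a)$ and $[\overset{\rightarrow}{X},\overset{\rightarrow}{Y}](a)$. Then $[\cdot,\cdot]_l$ and $[\cdot,\cdot]_r$ are skew algebroid brackets on $AG$ with the anchors $\rho_l(x)=T\beta(\bar x^{\alpha})$ and $\rho_r(x)=T\alpha(\bar x^{\beta})$, respectively. That is, each bracket $[\cdot,\cdot]$ maps pairs of smooth sections of $AG$ to smooth sections of $AG$, is $\mathbb R$-bilinear and skew-symmetric, its anchor $\rho:AG\to TM$ is a (smooth) vector bundle morphism, and $$[X,fY]=\rho(X)(f)\,Y+f\,[X,Y]$$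 for all smooth sections $X,Y$ of $AG$ and all $f\in C^\infty(M)$. Moreover, $\rho_r=-\rho_l$. -/

import Mathlib

open Set Filter Topology
open scoped Manifold ContDiff Bundle

noncomputable section

open Classical in
/-- A smooth quasiloopoid `G ⇉ M`.  Here `G` and `M` are smooth manifolds modelled on the vector
spaces `E` and `F`.  The manifold of units `M` is given with its inclusion `ε : M → G`; since `ε` is
smooth with smooth left inverse `α`, it is automatically an embedding of manifolds (closed, as `G` is Hausdorff).
The condition `α ∘ ε = id` (resp. `β ∘ ε = id`) is forced by the requirement that
the products `g β(g)` (resp. `α(g) g`) be defined for all `g`, as `α` and `β` are onto.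

The product `mul g h _` is defined exactly for the pairs with `β g = α h`.  The set
`G⁽²⁾ = {(g, h) | β g = α h}` is automatically a closed embedded submanifold of `G × G`
(as `α`, `β` are submersions), and smoothness of a map on an embedded submanifold is
expressed by `ContMDiffOn` on that subset; this does not depend on the arbitrary values that are
used outside `G⁽²⁾` to write the map as a function on `G × G`. -/
structure SmoothQuasiloopoid
    (E : Type*) [NormedAddCommGroup E] [NormedSpace ℝ E]
    (F : Type*) [NormedAddCommGroup F] [NormedSpace ℝ F]
    (G : Type*) [TopologicalSpace G] [ChartedSpace E G] [IsManifold 𝓘(ℝ, E) ∞ G]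
    (M : Type*) [TopologicalSpace M] [ChartedSpace F M] [IsManifold 𝓘(ℝ, F) ∞ M] where
  /-- the target map -/
  α : G → M
  /-- the source map -/
  β : G → M
  /-- the inclusion of the manifold of units -/
  ε : M → G
  /-- the partial product -/
  mul : ∀ g h : G, β g = α h → G
  α_surjective : Function.Surjective α
  β_surjective : Function.Surjective β
  α_submersion : Manifold.IsSubmersion 𝓘(ℝ, E) 𝓘(ℝ, F) ∞ α
  β_submersion : Manifold.IsSubmersion 𝓘(ℝ, E) 𝓘(ℝ, F) ∞ β
  ε_smooth : ContMDiff 𝓘(ℝ, F) 𝓘(ℝ, E) ∞ ε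
  α_ε : ∀ a, α (ε a) = a
  β_ε : ∀ a, β (ε a) = a
  mul_smooth : ContMDiffOn (𝓘(ℝ, E).prod 𝓘(ℝ, E)) 𝓘(ℝ, E) ∞
    (fun p : G × G => if c : β p.1 = α p.2 then mul p.1 p.2 c else p.1)
    {p : G × G | β p.1 = α p.2}
  mul_unit : ∀ g, mul g (ε (β g)) (α_ε (β g)).symm = g
  unit_mul : ∀ h, mul (ε (α h)) h (β_ε (α h)) = h
  /-- the left translation `h ↦ g h` is injective on the fibre `{h | α h = β g}` -/
  left_injective : ∀ (g h h' : G) (c : β g = α h) (c' : β g = α h'),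
    mul g h c = mul g h' c' → h = h'
  /-- the right translation `g ↦ g h` is injective on the fibre `{g | β g = α h}` -/
  right_injective : ∀ (h g g' : G) (c : β g = α h) (c' : β g' = α h),
    mul g h c = mul g' h c' → g = g'
  /-- the left translation by `g` is an immersion: its differential is injective on
  the tangent spaces `ker (T_h α)` of the fibre `{h | α h = β g}` -/
  left_immersion : ∀ g h : G, β g = α h → ∀ v : TangentSpace 𝓘(ℝ, E) h,
    mfderiv 𝓘(ℝ, E) 𝓘(ℝ, F) α h v = 0 →
    mfderivWithin 𝓘(ℝ, E) 𝓘(ℝ, E) (fun k => if c : β g = α k then mul g k c else g)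
      {k | α k = β g} h v = 0 → v = 0
  /-- the right translation by `h` is an immersion: its differential is injective on
  the tangent spaces `ker (T_g β)` of the fibre `{g | β g = α h}` -/
  right_immersion : ∀ h g : G, β g = α h → ∀ v : TangentSpace 𝓘(ℝ, E) g,
    mfderiv 𝓘(ℝ, E) 𝓘(ℝ, F) β g v = 0 →
    mfderivWithin 𝓘(ℝ, E) 𝓘(ℝ, E) (fun k => if c : β k = α h then mul k h c else h)
      {k | β k = α h} g v = 0 → v = 0

namespace SmoothQuasiloopoid

variable {E : Type*} [NormedAddCommGroup E] [NormedSpace ℝ E]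
  {F : Type*} [NormedAddCommGroup F] [NormedSpace ℝ F]
  {G : Type*} [TopologicalSpace G] [ChartedSpace E G] [IsManifold 𝓘(ℝ, E) ∞ G]
  {M : Type*} [TopologicalSpace M] [ChartedSpace F M] [IsManifold 𝓘(ℝ, F) ∞ M]
  (Q : SmoothQuasiloopoid E F G M)

open Classical in
/-- The left translation `l_g : {h | α h = β g} → G`, `l_g h = g h` (the value outside the fibre is
arbitrary and never used). -/
def leftTranslation (g h : G) : G := if c : Q.β g = Q.α h then Q.mul g h c else g

open Classical in
/-- The right translation `r_h : {g | β g = α h} → G`, `r_h g = g h` (the value outside the fibre is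
arbitrary and never used). -/
def rightTranslation (h g : G) : G := if c : Q.β g = Q.α h then Q.mul g h c else h

/-- `T_a α : T_a G → T_a M` at a unit `a ∈ M`. -/
def tangentα (a : M) : TangentSpace 𝓘(ℝ, E) (Q.ε a) →L[ℝ] TangentSpace 𝓘(ℝ, F) a :=
  mfderiv 𝓘(ℝ, E) 𝓘(ℝ, F) Q.α (Q.ε a)

/-- `T_a β : T_a G → T_a M` at a unit `a ∈ M`. -/
def tangentβ (a : M) : TangentSpace 𝓘(ℝ, E) (Q.ε a) →L[ℝ] TangentSpace 𝓘(ℝ, F) a :=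
  mfderiv 𝓘(ℝ, E) 𝓘(ℝ, F) Q.β (Q.ε a)

/-- `T_a ε : T_a M → T_a G`, the inclusion of tangent spaces at a unit. -/
def tangentε (a : M) : TangentSpace 𝓘(ℝ, F) a →L[ℝ] TangentSpace 𝓘(ℝ, E) (Q.ε a) :=
  mfderiv 𝓘(ℝ, F) 𝓘(ℝ, E) Q.ε a

/-- The subspace `T_a M ⊆ T_a G` at a unit `a`. -/
def unitTangent (a : M) : Submodule ℝ (TangentSpace 𝓘(ℝ, E) (Q.ε a)) :=
  LinearMap.range (Q.tangentε a).toLinearMap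

/-- The fibre `A_a G = T_a G / T_a M` of the normal bundle `AG = ν(G, M) = TG|_M / TM`. -/
abbrev Normal (a : M) : Type _ := TangentSpace 𝓘(ℝ, E) (Q.ε a) ⧸ Q.unitTangent a

/-! ### Vertical representatives of normal vectors -/

lemma tangentα_tangentε (a : M) (w : TangentSpace 𝓘(ℝ, F) a) :
    Q.tangentα a (Q.tangentε a w) = w := by
  have hid : Q.α ∘ Q.ε = id := funext Q.α_ε
  have h := mfderiv_comp a
    (Q.α_submersion.contMDiff.contMDiffAt.mdifferentiableAt (by simp))
    (Q.ε_smooth.contMDiffAt.mdifferentiableAt (by simp))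
  rw [hid, mfderiv_id] at h
  exact (congrArg (fun L : F →L[ℝ] F => L w) h).symm

lemma tangentβ_tangentε (a : M) (w : TangentSpace 𝓘(ℝ, F) a) :
    Q.tangentβ a (Q.tangentε a w) = w := by
  have hid : Q.β ∘ Q.ε = id := funext Q.β_ε
  have h := mfderiv_comp a
    (Q.β_submersion.contMDiff.contMDiffAt.mdifferentiableAt (by simp))
    (Q.ε_smooth.contMDiffAt.mdifferentiableAt (by simp))
  rw [hid, mfderiv_id] at h
  exact (congrArg (fun L : F →L[ℝ] F => L w) h).symm

/-- For `x ∈ A_a G`, the unique representative `x̄^α` of `x` that is tangent to the `α`-fibre. -/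
def repα (a : M) : Q.Normal a →ₗ[ℝ] TangentSpace 𝓘(ℝ, E) (Q.ε a) :=
  (Q.unitTangent a).liftQ
    (LinearMap.id - (Q.tangentε a ∘L Q.tangentα a).toLinearMap) (by
      rintro _ ⟨w, rfl⟩
      simp [Q.tangentα_tangentε])

/-- For `x ∈ A_a G`, the unique representative `x̄^β` of `x` that is tangent to the `β`-fibre. -/
def repβ (a : M) : Q.Normal a →ₗ[ℝ] TangentSpace 𝓘(ℝ, E) (Q.ε a) :=
  (Q.unitTangent a).liftQ
    (LinearMap.id - (Q.tangentε a ∘L Q.tangentβ a).toLinearMap) (by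
      rintro _ ⟨w, rfl⟩
      simp [Q.tangentβ_tangentε])

/-- `repα` is characterized by: it represents the given normal vector and is killed by `Tα`. -/
lemma eq_repα_iff (a : M) (x : Q.Normal a) (v : TangentSpace 𝓘(ℝ, E) (Q.ε a)) :
    v = Q.repα a x ↔ (Submodule.Quotient.mk v : Q.Normal a) = x ∧ Q.tangentα a v = 0 := by
  obtain ⟨u, rfl⟩ := Submodule.Quotient.mk_surjective _ x
  have hu : Q.repα a (Submodule.Quotient.mk u) = u - Q.tangentε a (Q.tangentα a u) := rfl
  rw [hu, Submodule.Quotient.eq]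
  constructor
  · rintro rfl
    refine ⟨⟨-Q.tangentα a u, ?_⟩, ?_⟩
    · change Q.tangentε a (-Q.tangentα a u) = _
      rw [map_neg]
      abel
    · rw [map_sub, Q.tangentα_tangentε, sub_self]
  · rintro ⟨⟨w, hw⟩, hv⟩
    replace hw : Q.tangentε a w = v - u := hw
    have h := Q.tangentα_tangentε a w
    rw [hw, map_sub, hv, zero_sub] at h
    have h2 : Q.tangentε a (Q.tangentα a u) = u - v := by
      rw [← neg_eq_iff_eq_neg.2 h.symm, map_neg, hw]
      abel
    rw [h2]
    abel

/-- `repβ` is characterized by: it represents the given normal vector and is killed by `Tβ`. -/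
lemma eq_repβ_iff (a : M) (x : Q.Normal a) (v : TangentSpace 𝓘(ℝ, E) (Q.ε a)) :
    v = Q.repβ a x ↔ (Submodule.Quotient.mk v : Q.Normal a) = x ∧ Q.tangentβ a v = 0 := by
  obtain ⟨u, rfl⟩ := Submodule.Quotient.mk_surjective _ x
  have hu : Q.repβ a (Submodule.Quotient.mk u) = u - Q.tangentε a (Q.tangentβ a u) := rfl
  rw [hu, Submodule.Quotient.eq]
  constructor
  · rintro rfl
    refine ⟨⟨-Q.tangentβ a u, ?_⟩, ?_⟩
    · change Q.tangentε a (-Q.tangentβ a u) = _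
      rw [map_neg]
      abel
    · rw [map_sub, Q.tangentβ_tangentε, sub_self]
  · rintro ⟨⟨w, hw⟩, hv⟩
    replace hw : Q.tangentε a w = v - u := hw
    have h := Q.tangentβ_tangentε a w
    rw [hw, map_sub, hv, zero_sub] at h
    have h2 : Q.tangentε a (Q.tangentβ a u) = u - v := by
      rw [← neg_eq_iff_eq_neg.2 h.symm, map_neg, hw]
      abel
    rw [h2]
    abel

/-! ### Smooth sections of the normal bundle -/

/-- `V` is a smooth section of `TG|_M` over the set `U ⊆ M`. -/
def SmoothAlong (V : ∀ a : M, TangentSpace 𝓘(ℝ, E) (Q.ε a)) (U : Set M) : Prop :=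
  ContMDiffOn 𝓘(ℝ, F) (𝓘(ℝ, E).prod 𝓘(ℝ, E)) ∞
    (fun a => (⟨Q.ε a, V a⟩ : TangentBundle 𝓘(ℝ, E) G)) U

lemma smoothAlong_iff (V : ∀ a : M, TangentSpace 𝓘(ℝ, E) (Q.ε a)) (U : Set M) :
    Q.SmoothAlong V U ↔ ∀ a ∈ U, ContMDiffWithinAt 𝓘(ℝ, F) 𝓘(ℝ, E) ∞
      (fun b => (trivializationAt E (TangentSpace 𝓘(ℝ, E)) (Q.ε a)
        (⟨Q.ε b, V b⟩ : TangentBundle 𝓘(ℝ, E) G)).2) U a := by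
  refine forall₂_congr fun a ha => ?_
  rw [Bundle.contMDiffWithinAt_totalSpace]
  exact and_iff_right Q.ε_smooth.contMDiffAt.contMDiffWithinAt

lemma eventually_mem_baseSet (U : Set M) (a : M) :
    ∀ᶠ b in 𝓝[U] a, Q.ε b ∈ (trivializationAt E (TangentSpace 𝓘(ℝ, E)) (Q.ε a)).baseSet :=
  mem_nhdsWithin_of_mem_nhds <| Q.ε_smooth.continuous.continuousAt.preimage_mem_nhds <|
    (trivializationAt E (TangentSpace 𝓘(ℝ, E)) (Q.ε a)).open_baseSet.mem_nhds <|
      FiberBundle.mem_baseSet_trivializationAt' _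

lemma SmoothAlong.mono {V : ∀ a : M, TangentSpace 𝓘(ℝ, E) (Q.ε a)} {U U' : Set M}
    (hV : Q.SmoothAlong V U) (h : U' ⊆ U) : Q.SmoothAlong V U' :=
  ContMDiffOn.mono hV h

lemma SmoothAlong.add {V W : ∀ a : M, TangentSpace 𝓘(ℝ, E) (Q.ε a)} {U : Set M}
    (hV : Q.SmoothAlong V U) (hW : Q.SmoothAlong W U) :
    Q.SmoothAlong (fun a => V a + W a) U := by
  rw [smoothAlong_iff] at hV hW ⊢
  intro a ha
  refine ((hV a ha).add (hW a ha)).congr_of_eventuallyEq_of_mem ?_ ha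
  filter_upwards [Q.eventually_mem_baseSet U a] with b hb
  exact ((trivializationAt E (TangentSpace 𝓘(ℝ, E)) (Q.ε a)).linear ℝ hb).1 _ _

lemma SmoothAlong.smul {V : ∀ a : M, TangentSpace 𝓘(ℝ, E) (Q.ε a)} {U : Set M}
    (hV : Q.SmoothAlong V U) {f : M → ℝ} (hf : ContMDiff 𝓘(ℝ, F) 𝓘(ℝ, ℝ) ∞ f) :
    Q.SmoothAlong (fun a => f a • V a) U := by
  rw [smoothAlong_iff] at hV ⊢
  intro a ha
  refine ((hf a).contMDiffWithinAt.smul (hV a ha)).congr_of_eventuallyEq_of_mem ?_ ha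
  filter_upwards [Q.eventually_mem_baseSet U a] with b hb
  exact ((trivializationAt E (TangentSpace 𝓘(ℝ, E)) (Q.ε a)).linear ℝ hb).2 _ _

lemma smoothAlong_zero (U : Set M) : Q.SmoothAlong (fun _ => 0) U := by
  rw [smoothAlong_iff]
  intro a ha
  refine (contMDiffWithinAt_const (c := (0 : E))).congr_of_eventuallyEq_of_mem ?_ ha
  filter_upwards [Q.eventually_mem_baseSet U a] with b hb
  exact ((trivializationAt E (TangentSpace 𝓘(ℝ, E)) (Q.ε a)).linear ℝ hb).map_zero

/-- A section of `AG = TG|_M / TM` is smooth if it is locally the class of a smooth section of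
`TG|_M`. -/
def IsSmoothSection (X : ∀ a : M, Q.Normal a) : Prop :=
  ∀ a₀ : M, ∃ U ∈ 𝓝 a₀, ∃ V : ∀ a : M, TangentSpace 𝓘(ℝ, E) (Q.ε a),
    Q.SmoothAlong V U ∧ ∀ a ∈ U, (Submodule.Quotient.mk (V a) : Q.Normal a) = X a

lemma IsSmoothSection.smul {X : ∀ a : M, Q.Normal a} (hX : Q.IsSmoothSection X) {f : M → ℝ}
    (hf : ContMDiff 𝓘(ℝ, F) 𝓘(ℝ, ℝ) ∞ f) : Q.IsSmoothSection (fun a => f a • X a) := by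
  intro a₀
  obtain ⟨U, hU, V, hV, h⟩ := hX a₀
  exact ⟨U, hU, fun a => f a • V a, hV.smul Q hf, fun a ha => by
    rw [Submodule.Quotient.mk_smul, h a ha]⟩

/-- The real vector space `Sec(AG)` of smooth sections of the normal bundle. -/
def Sections : Submodule ℝ (∀ a : M, Q.Normal a) where
  carrier := {X | Q.IsSmoothSection X}
  zero_mem' := fun _ => ⟨univ, univ_mem, fun _ => 0, Q.smoothAlong_zero univ, fun _ _ => rfl⟩
  add_mem' := by
    intro X Y hX hY a₀
    obtain ⟨U, hU, V, hV, h⟩ := hX a₀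
    obtain ⟨U', hU', V', hV', h'⟩ := hY a₀
    refine ⟨U ∩ U', inter_mem hU hU', fun a => V a + V' a,
      (hV.mono Q inter_subset_left).add Q (hV'.mono Q inter_subset_right), fun a ha => ?_⟩
    rw [Submodule.Quotient.mk_add, h a ha.1, h' a ha.2]
    rfl
  smul_mem' := fun _ _ hX => hX.smul Q contMDiff_const

/-- The product `f X` of a section `X` of `AG` with a smooth function `f` on `M`. -/
def smulSection (f : C^∞⟮𝓘(ℝ, F), M; 𝓘(ℝ, ℝ), ℝ⟯) (X : Q.Sections) : Q.Sections :=
  ⟨fun a => f a • X.1 a, X.2.smul Q f.contMDiff⟩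

/-! ### Skew algebroid structures on the normal bundle -/

/-- A skew algebroid structure on `AG`: a skew-symmetric `ℝ`-bilinear bracket on `Sec(AG)` with
a vector bundle morphism `ρ : AG → TM` (a family of linear maps of the fibres that maps smooth
sections to smooth vector fields) such that `[X, f Y] = ρ(X)(f) Y + f [X, Y]`. -/
structure SkewAlgebroid where
  bracket : Q.Sections →ₗ[ℝ] Q.Sections →ₗ[ℝ] Q.Sections
  anchor : ∀ a : M, Q.Normal a →ₗ[ℝ] TangentSpace 𝓘(ℝ, F) a
  anchor_smooth : ∀ X : Q.Sections, ContMDiff 𝓘(ℝ, F) (𝓘(ℝ, F).prod 𝓘(ℝ, F)) ∞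
    (fun a => (⟨a, anchor a (X.1 a)⟩ : TangentBundle 𝓘(ℝ, F) M))
  skew : ∀ X Y : Q.Sections, bracket X Y = -bracket Y X
  leibniz : ∀ (X Y : Q.Sections) (f : C^∞⟮𝓘(ℝ, F), M; 𝓘(ℝ, ℝ), ℝ⟯) (a : M),
    (bracket X (Q.smulSection f Y)).1 a =
      mvfderiv 𝓘(ℝ, F) f a (anchor a (X.1 a)) • Y.1 a + f a • (bracket X Y).1 a

/-! ### Prolongations, brackets and anchors -/

/-- The left prolongation `g ↦ (T_{β(g)} l_g)(X̄^α(β(g)))` of a section `X` of `AG`, where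
`l_g` is a map on the fibre `{h | α h = β g}`.  It is a vector in `T_g G` as `l_g (β g) = g`. -/
def leftProlongation (X : ∀ a : M, Q.Normal a) (g : G) : TangentSpace 𝓘(ℝ, E) g :=
  mfderivWithin 𝓘(ℝ, E) 𝓘(ℝ, E) (Q.leftTranslation g) {h | Q.α h = Q.β g} (Q.ε (Q.β g))
    (Q.repα (Q.β g) (X (Q.β g)))

/-- The right prolongation `h ↦ (T_{α(h)} r_h)(X̄^β(α(h)))` of a section `X` of `AG`, where
`r_h` is a map on the fibre `{g | β g = α h}`.  It is a vector in `T_h G` as `r_h (α h) = h`. -/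
def rightProlongation (X : ∀ a : M, Q.Normal a) (h : G) : TangentSpace 𝓘(ℝ, E) h :=
  mfderivWithin 𝓘(ℝ, E) 𝓘(ℝ, E) (Q.rightTranslation h) {g | Q.β g = Q.α h} (Q.ε (Q.α h))
    (Q.repβ (Q.α h) (X (Q.α h)))

/-- `[X, Y]_l(a)`: the class in `A_a G` of the value at `a ∈ M` of the Lie bracket of the left
prolongations. -/
def leftBracket (X Y : ∀ a : M, Q.Normal a) (a : M) : Q.Normal a :=
  Submodule.Quotient.mk (VectorField.mlieBracket 𝓘(ℝ, E) (Q.leftProlongation X)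
    (Q.leftProlongation Y) (Q.ε a))

/-- `[X, Y]_r(a)`: the class in `A_a G` of the value at `a ∈ M` of the Lie bracket of the right
prolongations. -/
def rightBracket (X Y : ∀ a : M, Q.Normal a) (a : M) : Q.Normal a :=
  Submodule.Quotient.mk (VectorField.mlieBracket 𝓘(ℝ, E) (Q.rightProlongation X)
    (Q.rightProlongation Y) (Q.ε a))

/-- `ρ_l(x) = Tβ(x̄^α)`. -/
def leftAnchor (a : M) : Q.Normal a →ₗ[ℝ] TangentSpace 𝓘(ℝ, F) a :=
  (Q.tangentβ a).toLinearMap ∘ₗ Q.repα a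

/-- `ρ_r(x) = Tα(x̄^β)`. -/
def rightAnchor (a : M) : Q.Normal a →ₗ[ℝ] TangentSpace 𝓘(ℝ, F) a :=
  (Q.tangentα a).toLinearMap ∘ₗ Q.repβ a

end SmoothQuasiloopoid

end

/-!
The point of the proof is the smoothness of the left prolongation `X←(g) = T l_g (X̄^α(β g))`, where
the translation `l_g` is defined on the fibre `α⁻¹(β g)` only. As `α` is a submersion, there is,
locally, a smooth family of retractions `P (b, ·)` onto the fibres `α⁻¹(b)`, with `P (α x, x) = x`
(`Manifold.IsSubmersionAtOfComplement.exists_fibre_retraction`). Then `Θ (g, x) = g · P (β g, x)` is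
a smooth map on an open subset of `G × G`, and differentiating `P (α x, x) = x` shows that `P (b, ·)`
has the identity as differential on vertical vectors. Hence `X←(g)` is the image under `TΘ` of the
vector `(0, X̄^α(β g))` at `(g, β g)`, which depends smoothly on `g`
(`leftProlongation_eq_mfderiv`, `contMDiff_leftProlongation`).

The bracket then inherits its properties from the Lie bracket of vector fields on `G`. For the
Leibniz rule two facts are needed: `f X` prolongs to `(f ∘ β) X←`, and `X←(a) = X̄^α(a)` at a unit `a`,
because `l_a` is the identity of `α⁻¹(a)` (`leftProlongation_ε`). So the derivative of `f ∘ β` along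
`X←` at `a` is `ρ_l(X)(f)(a)`, and the class of `Y←(a)` in `A_a G` is `Y(a)`.

The right prolongations are the left prolongations of the opposite quasiloopoid, in which `α` and `β`
are exchanged and the product is reversed. Finally, if `u` represents `x` and `M` is identified with
its image in `G`, then `x̄^α = u - Tα u` and `x̄^β = u - Tβ u`, so `ρ_l(x) = Tβ u - Tα u = -ρ_r(x)`.
-/

noncomputable section

/-! ### Retractions onto the fibres of a submersion -/

/-- Near a point `x₀`, a submersion `f` admits a smooth family of retractions onto its fibres:
`P (b, x)` lies in the fibre over `b`, and `P (b, x) = x` if `x` already lies in that fibre.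
In charts in which `f` is the projection `(u, v) ↦ u`, the map is `(b, (u, v)) ↦ (b, v)`. -/
theorem Manifold.IsSubmersionAtOfComplement.exists_fibre_retraction
    {E : Type*} [NormedAddCommGroup E] [NormedSpace ℝ E]
    {F : Type*} [NormedAddCommGroup F] [NormedSpace ℝ F]
    {K : Type*} [NormedAddCommGroup K] [NormedSpace ℝ K]
    {G : Type*} [TopologicalSpace G] [ChartedSpace E G]
    {M : Type*} [TopologicalSpace M] [ChartedSpace F M] {f : G → M} {x₀ : G}
    (h : Manifold.IsSubmersionAtOfComplement K 𝓘(ℝ, E) 𝓘(ℝ, F) ∞ f x₀) :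
    ∃ (P : M × G → G) (W : Set (M × G)), IsOpen W ∧
      ContMDiffOn (𝓘(ℝ, F).prod 𝓘(ℝ, E)) 𝓘(ℝ, E) ∞ P W ∧ (∀ p ∈ W, f (P p) = p.1) ∧
      ∀ᶠ x in 𝓝 x₀, (f x, x) ∈ W ∧ P (f x, x) = x := by
  have hwrit : ∀ y ∈ h.domChart.target, h.codChart (f (h.domChart.symm y)) = (h.equiv y).1 := by
    intro y hy
    have := h.writtenInCharts (show y ∈ (h.domChart.extend 𝓘(ℝ, E)).target by simpa using hy)
    simpa using this
  set φ := h.domChart with hφ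
  set ψ := h.codChart with hψ
  set e := h.equiv with he
  let q : M × G → E := fun p => e.symm (ψ p.1, (e (φ p.2)).2)
  have hq : ContMDiffOn (𝓘(ℝ, F).prod 𝓘(ℝ, E)) 𝓘(ℝ, E) ∞ q (ψ.source ×ˢ φ.source) := by
    have h1 : ContMDiffOn (𝓘(ℝ, F).prod 𝓘(ℝ, E)) 𝓘(ℝ, F) ∞ (fun p : M × G => ψ p.1)
        (ψ.source ×ˢ φ.source) :=
      (contMDiffOn_of_mem_maximalAtlas h.codChart_mem_maximalAtlas).comp contMDiffOn_fst
        fun p hp => hp.1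
    have h2 : ContMDiffOn (𝓘(ℝ, F).prod 𝓘(ℝ, E)) 𝓘(ℝ, E) ∞ (fun p : M × G => φ p.2)
        (ψ.source ×ˢ φ.source) :=
      (contMDiffOn_of_mem_maximalAtlas h.domChart_mem_maximalAtlas).comp contMDiffOn_snd
        fun p hp => hp.2
    have h3 : ContDiff ℝ ∞ (fun z : F × E => e.symm (z.1, (e z.2).2)) := by fun_prop
    exact h3.contMDiff.comp_contMDiffOn (h1.prodMk_space h2)
  have hfφ : ∀ x ∈ φ.source, f x ∈ ψ.source ∧ q (f x, x) = φ x := by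
    intro x hx
    refine ⟨h.source_subset_preimage_source hx, ?_⟩
    have := hwrit (φ x) (φ.map_source hx)
    rw [φ.left_inv hx] at this
    simp only [q, this, Prod.mk.eta, e.symm_apply_apply]
  refine ⟨fun p => φ.symm (q p), (ψ.source ×ˢ φ.source) ∩ q ⁻¹' φ.target,
    hq.continuousOn.isOpen_inter_preimage (ψ.open_source.prod φ.open_source) φ.open_target,
    ?_, ?_, ?_⟩
  · exact (contMDiffOn_symm_of_mem_maximalAtlas h.domChart_mem_maximalAtlas).comp
      (hq.mono inter_subset_left) fun p hp => hp.2
  · rintro p ⟨⟨hp1, hp2⟩, hp3⟩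
    refine ψ.injOn (h.source_subset_preimage_source (φ.map_target hp3)) hp1 ?_
    rw [hwrit _ hp3]
    simp [q]
  · filter_upwards [φ.open_source.mem_nhds h.mem_domChart_source] with x hx
    obtain ⟨h1, h2⟩ := hfφ x hx
    refine ⟨⟨⟨h1, hx⟩, ?_⟩, ?_⟩
    · rw [mem_preimage, h2]; exact φ.map_source hx
    · rw [h2, φ.left_inv hx]

namespace SmoothQuasiloopoid

variable {E : Type*} [NormedAddCommGroup E] [NormedSpace ℝ E]
  {F : Type*} [NormedAddCommGroup F] [NormedSpace ℝ F]
  {G : Type*} [TopologicalSpace G] [ChartedSpace E G] [IsManifold 𝓘(ℝ, E) ∞ G]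
  {M : Type*} [TopologicalSpace M] [ChartedSpace F M] [IsManifold 𝓘(ℝ, F) ∞ M]
  (Q : SmoothQuasiloopoid E F G M)

/-! ### The vertical lift of a normal section -/

lemma tangentα_repα (a : M) (x : Q.Normal a) : Q.tangentα a (Q.repα a x) = 0 :=
  ((Q.eq_repα_iff a x _).1 rfl).2

lemma mk_repα (a : M) (x : Q.Normal a) :
    (Submodule.Quotient.mk (Q.repα a x) : Q.Normal a) = x :=
  ((Q.eq_repα_iff a x _).1 rfl).1

lemma repα_mk (a : M) (v : TangentSpace 𝓘(ℝ, E) (Q.ε a)) :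
    Q.repα a (Submodule.Quotient.mk v) = v - Q.tangentε a (Q.tangentα a v) := rfl

/-- The image of a smooth section of `TG` along `M` under `T(ε ∘ α)` is again one. -/
lemma SmoothAlong.tangentε_tangentα {V : ∀ a : M, TangentSpace 𝓘(ℝ, E) (Q.ε a)} {U : Set M}
    (hV : Q.SmoothAlong V U) : Q.SmoothAlong (fun a => Q.tangentε a (Q.tangentα a (V a))) U := by
  have hα := Q.α_submersion.contMDiff
  have h := ((Q.ε_smooth.comp hα).contMDiff_tangentMap (m := ∞) (by simp)).comp_contMDiffOn hV
  refine h.congr fun a _ => ?_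
  have hcomp : mfderiv 𝓘(ℝ, E) 𝓘(ℝ, E) (Q.ε ∘ Q.α) (Q.ε a) =
      (mfderiv 𝓘(ℝ, F) 𝓘(ℝ, E) Q.ε (Q.α (Q.ε a))).comp
        (mfderiv 𝓘(ℝ, E) 𝓘(ℝ, F) Q.α (Q.ε a)) :=
    mfderiv_comp _ (Q.ε_smooth.mdifferentiableAt (by simp)) (hα.mdifferentiableAt (by simp))
  have hbase : ∀ b : M, b = a → ∀ w : F, (⟨Q.ε a, Q.tangentε a w⟩ : TangentBundle 𝓘(ℝ, E) G) =
      ⟨Q.ε b, mfderiv 𝓘(ℝ, F) 𝓘(ℝ, E) Q.ε b w⟩ := by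
    rintro b rfl w
    rfl
  refine (hbase _ (Q.α_ε a) _).trans ?_
  exact congrArg (fun L : E →L[ℝ] E =>
    (⟨Q.ε (Q.α (Q.ε a)), L (V a)⟩ : TangentBundle 𝓘(ℝ, E) G)) hcomp.symm

lemma smoothAlong_repα {X : ∀ a : M, Q.Normal a} (hX : Q.IsSmoothSection X) :
    Q.SmoothAlong (fun a => Q.repα a (X a)) univ := by
  intro a₀ _
  obtain ⟨U, hU, V, hV, h⟩ := hX a₀
  have h1 : Q.SmoothAlong (fun a => V a + (-1 : ℝ) • Q.tangentε a (Q.tangentα a (V a))) U :=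
    hV.add Q ((hV.tangentε_tangentα Q).smul Q contMDiff_const)
  refine ((h1.contMDiffAt hU).congr_of_eventuallyEq ?_).contMDiffWithinAt
  filter_upwards [hU] with a ha
  rw [← h a ha, repα_mk, neg_one_smul, sub_eq_add_neg]

/-! ### Left prolongations -/

/-- Left translations are differentiable along the fibres of `α`. -/
lemma mdifferentiableWithinAt_leftTranslation {g h : G} (hgh : Q.α h = Q.β g) :
    MDifferentiableWithinAt 𝓘(ℝ, E) 𝓘(ℝ, E) (Q.leftTranslation g) {k | Q.α k = Q.β g} h := by
  have h1 := (Q.mul_smooth (g, h) hgh.symm).mdifferentiableWithinAt (by simp)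
  have h2 : MDifferentiableWithinAt 𝓘(ℝ, E) (𝓘(ℝ, E).prod 𝓘(ℝ, E)) (fun k : G => (g, k))
      {k | Q.α k = Q.β g} h :=
    (mdifferentiableAt_const.prodMk mdifferentiableAt_id).mdifferentiableWithinAt
  exact MDifferentiableWithinAt.comp h h1 h2 fun k hk => hk.symm

/-- The derivative of the left translation `l_g`, which is defined on an `α`-fibre only, can be
computed in a direction `v` as an unrestricted derivative: precompose `l_g` with a map `k` of a
neighbourhood of the unit into the fibre that fixes the unit and whose differential fixes `v`.
The fibre does not determine derivatives uniquely, so `mfderivWithin` involves a choice; such a map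
exists for vertical `v`, and for these the lemma shows that the choice does not matter. -/
lemma mfderivWithin_leftTranslation_eq {g : G} {k : G → G} {v : E}
    (hk : MDifferentiableAt 𝓘(ℝ, E) 𝓘(ℝ, E) k (Q.ε (Q.β g)))
    (hk₀ : k (Q.ε (Q.β g)) = Q.ε (Q.β g))
    (hkα : ∀ᶠ x in 𝓝 (Q.ε (Q.β g)), Q.α (k x) = Q.β g)
    (hkv : (mfderiv 𝓘(ℝ, E) 𝓘(ℝ, E) k (Q.ε (Q.β g)) v : E) = v) :
    (mfderivWithin 𝓘(ℝ, E) 𝓘(ℝ, E) (Q.leftTranslation g) {h | Q.α h = Q.β g} (Q.ε (Q.β g)) v : E)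
      = mfderiv 𝓘(ℝ, E) 𝓘(ℝ, E) (Q.leftTranslation g ∘ k) (Q.ε (Q.β g)) v := by
  let L : E →L[ℝ] E :=
    mfderivWithin 𝓘(ℝ, E) 𝓘(ℝ, E) (Q.leftTranslation g) {h | Q.α h = Q.β g} (Q.ε (Q.β g))
  have hL : ∀ y, y = Q.ε (Q.β g) → HasMFDerivWithinAt 𝓘(ℝ, E) 𝓘(ℝ, E) (Q.leftTranslation g)
      {h | Q.α h = Q.β g} y L := by
    rintro y rfl
    exact (Q.mdifferentiableWithinAt_leftTranslation (Q.α_ε _)).hasMFDerivWithinAt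
  have hcomp := HasMFDerivWithinAt.comp _ (hL _ hk₀)
    (hk.hasMFDerivAt.hasMFDerivWithinAt (s := {x | Q.α (k x) = Q.β g})) fun x hx => hx
  have := (hcomp.hasMFDerivAt hkα).mfderiv
  rw [this]
  exact congrArg L hkv.symm

/-- A retraction onto a fibre of `α` that comes from a smooth family is infinitesimally the
identity on vertical vectors: differentiate `P (α x, x) = x` in a direction killed by `Tα`. -/
lemma mfderiv_retraction {P : M × G → G} {a : M}
    (hP : MDifferentiableAt (𝓘(ℝ, F).prod 𝓘(ℝ, E)) 𝓘(ℝ, E) P (a, Q.ε a))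
    (hPid : ∀ᶠ x in 𝓝 (Q.ε a), P (Q.α x, x) = x) {v : E} (hv : Q.tangentα a v = 0) :
    (mfderiv 𝓘(ℝ, E) 𝓘(ℝ, E) (fun x => P (a, x)) (Q.ε a) v : E) = v := by
  have hα : MDifferentiableAt 𝓘(ℝ, E) 𝓘(ℝ, F) Q.α (Q.ε a) :=
    Q.α_submersion.contMDiff.mdifferentiableAt (by simp)
  have h1 : (mfderiv 𝓘(ℝ, E) 𝓘(ℝ, E) (P ∘ fun x => (a, x)) (Q.ε a) v : E) =
      mfderiv (𝓘(ℝ, F).prod 𝓘(ℝ, E)) 𝓘(ℝ, E) P (a, Q.ε a) ((0 : F), v) := by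
    refine (mfderiv_comp_apply _ hP (mdifferentiableAt_const.prodMk mdifferentiableAt_id)
      v).trans ?_
    rw [mfderiv_prod_right]
    rfl
  have h2 : (mfderiv 𝓘(ℝ, E) 𝓘(ℝ, E) (P ∘ fun x => (Q.α x, x)) (Q.ε a) v : E) =
      mfderiv (𝓘(ℝ, F).prod 𝓘(ℝ, E)) 𝓘(ℝ, E) P (a, Q.ε a) ((0 : F), v) := by
    refine (mfderiv_comp_apply_of_eq _ (y := (a, Q.ε a)) hP (hα.prodMk mdifferentiableAt_id)
      (by rw [Q.α_ε, id]) v).trans ?_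
    rw [mfderiv_prodMk hα mdifferentiableAt_id, mfderiv_id]
    exact congrArg (fun w : F => (mfderiv (𝓘(ℝ, F).prod 𝓘(ℝ, E)) 𝓘(ℝ, E) P (a, Q.ε a)
      (w, v) : E)) hv
  have h3 : mfderiv 𝓘(ℝ, E) 𝓘(ℝ, E) (P ∘ fun x => (Q.α x, x)) (Q.ε a) =
      mfderiv 𝓘(ℝ, E) 𝓘(ℝ, E) id (Q.ε a) := Filter.EventuallyEq.mfderiv_eq hPid
  rw [mfderiv_id] at h3
  exact h1.trans (h2.symm.trans (congrArg (fun L : E →L[ℝ] E => L v) h3))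

/-- The left prolongation of `X` at `g` is the derivative of `(g, x) ↦ g · P (β g, x)` in the
direction of the second variable, for a family `P` of retractions onto the fibres of `α`. -/
lemma leftProlongation_eq_mfderiv {P : M × G → G} {W : Set (M × G)} (hW : IsOpen W)
    (hP : ContMDiffOn (𝓘(ℝ, F).prod 𝓘(ℝ, E)) 𝓘(ℝ, E) ∞ P W) (hPα : ∀ p ∈ W, Q.α (P p) = p.1)
    {g : G} (hPid : ∀ᶠ x in 𝓝 (Q.ε (Q.β g)), (Q.α x, x) ∈ W ∧ P (Q.α x, x) = x)
    (X : ∀ a : M, Q.Normal a) :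
    (Q.leftProlongation X g : E) =
      mfderiv 𝓘(ℝ, E) 𝓘(ℝ, E) (fun x => Q.leftTranslation g (P (Q.β g, x))) (Q.ε (Q.β g))
        (Q.repα (Q.β g) (X (Q.β g))) := by
  obtain ⟨hmem, hfix⟩ := hPid.self_of_nhds
  rw [Q.α_ε] at hmem hfix
  have hPd : MDifferentiableAt (𝓘(ℝ, F).prod 𝓘(ℝ, E)) 𝓘(ℝ, E) P (Q.β g, Q.ε (Q.β g)) :=
    (hP.contMDiffAt (hW.mem_nhds hmem)).mdifferentiableAt (by simp)
  have hin : MDifferentiableAt 𝓘(ℝ, E) (𝓘(ℝ, F).prod 𝓘(ℝ, E)) (fun x : G => (Q.β g, x))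
      (Q.ε (Q.β g)) := mdifferentiableAt_const.prodMk mdifferentiableAt_id
  refine Q.mfderivWithin_leftTranslation_eq (k := fun x => P (Q.β g, x))
    (hPd.comp _ hin) hfix ?_ ?_
  · filter_upwards [hin.continuousAt.preimage_mem_nhds (hW.mem_nhds hmem)] with x hx
    exact hPα _ hx
  · exact Q.mfderiv_retraction hPd (hPid.mono fun x hx => hx.2) (Q.tangentα_repα _ _)

/-- The left prolongation of a smooth section is a smooth vector field. -/
theorem contMDiff_leftProlongation {X : ∀ a : M, Q.Normal a} (hX : Q.IsSmoothSection X) :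
    ContMDiff 𝓘(ℝ, E) (𝓘(ℝ, E).prod 𝓘(ℝ, E)) ∞
      (fun g => (⟨g, Q.leftProlongation X g⟩ : TangentBundle 𝓘(ℝ, E) G)) := by
  intro g₀
  have hβ := Q.β_submersion.contMDiff
  have hεβ : ContMDiff 𝓘(ℝ, E) 𝓘(ℝ, E) ∞ (fun g => Q.ε (Q.β g)) := Q.ε_smooth.comp hβ
  obtain ⟨P, W, hW, hP, hPα, hPid⟩ := (Q.α_submersion.isSubmersionOfComplement_complement
    (Q.ε (Q.β g₀))).exists_fibre_retraction
  -- `Θ (g, x) = g · P (β g, x)` extends the product smoothly to pairs that are not composable.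
  let Θ : G × G → G := fun p => Q.leftTranslation p.1 (P (Q.β p.1, p.2))
  let Ω : Set (G × G) := {p | (Q.β p.1, p.2) ∈ W}
  have hβ2 : ContMDiff (𝓘(ℝ, E).prod 𝓘(ℝ, E)) (𝓘(ℝ, F).prod 𝓘(ℝ, E)) ∞
      (fun p : G × G => (Q.β p.1, p.2)) := (hβ.comp contMDiff_fst).prodMk contMDiff_snd
  have hΩ : IsOpen Ω := hW.preimage hβ2.continuous
  have hΘ : ContMDiffOn (𝓘(ℝ, E).prod 𝓘(ℝ, E)) 𝓘(ℝ, E) ∞ Θ Ω :=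
    Q.mul_smooth.comp (contMDiffOn_fst.prodMk (hP.comp hβ2.contMDiffOn fun p hp => hp))
      fun p hp => (hPα _ hp).symm
  have hTΘ := hΘ.contMDiffOn_tangentMapWithin (m := ∞) (by simp) hΩ.uniqueMDiffOn
  let S : G → TangentBundle (𝓘(ℝ, E).prod 𝓘(ℝ, E)) (G × G) := fun g =>
    ⟨(g, Q.ε (Q.β g)), ((0 : E), Q.repα (Q.β g) (X (Q.β g)))⟩
  have hS : ContMDiff 𝓘(ℝ, E) (𝓘(ℝ, E).prod 𝓘(ℝ, E)).tangent ∞ S := by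
    have h1 : ContMDiff 𝓘(ℝ, E) (𝓘(ℝ, E).prod 𝓘(ℝ, E)) ∞
        (Bundle.zeroSection E (TangentSpace 𝓘(ℝ, E) : G → Type _)) :=
      Bundle.contMDiff_zeroSection ℝ _
    have h2 : ContMDiff 𝓘(ℝ, E) (𝓘(ℝ, E).prod 𝓘(ℝ, E)) ∞ (fun g => (⟨Q.ε (Q.β g),
        Q.repα (Q.β g) (X (Q.β g))⟩ : TangentBundle 𝓘(ℝ, E) G)) :=
      (contMDiffOn_univ.1 (Q.smoothAlong_repα hX)).comp hβ
    exact contMDiff_equivTangentBundleProd_symm.comp (h1.prodMk h2)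
  have hmem : ∀ᶠ g in 𝓝 g₀, (g, Q.ε (Q.β g)) ∈ Ω ∧ ∀ᶠ x in 𝓝 (Q.ε (Q.β g)),
      (Q.α x, x) ∈ W ∧ P (Q.α x, x) = x := by
    filter_upwards [hεβ.continuous.continuousAt.eventually hPid.eventually_nhds] with g hg
    refine ⟨?_, hg⟩
    have := hg.self_of_nhds.1
    rwa [Q.α_ε] at this
  have hcomp := (hTΘ.contMDiffAt ((hΩ.preimage
    (FiberBundle.continuous_proj _ _)).mem_nhds hmem.self_of_nhds.1)).comp g₀ hS.contMDiffAt
  refine hcomp.congr_of_eventuallyEq ?_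
  filter_upwards [hmem] with g ⟨hgΩ, hg⟩
  have hval := Q.leftProlongation_eq_mfderiv hW hP hPα hg X
  have hΘd : MDifferentiableAt (𝓘(ℝ, E).prod 𝓘(ℝ, E)) 𝓘(ℝ, E) Θ (g, Q.ε (Q.β g)) :=
    (hΘ.contMDiffAt (hΩ.mem_nhds hgΩ)).mdifferentiableAt (by simp)
  have hpartial : (mfderiv 𝓘(ℝ, E) 𝓘(ℝ, E) (Θ ∘ fun x => (g, x)) (Q.ε (Q.β g))
        (Q.repα (Q.β g) (X (Q.β g))) : E) =
      mfderiv (𝓘(ℝ, E).prod 𝓘(ℝ, E)) 𝓘(ℝ, E) Θ (g, Q.ε (Q.β g))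
        ((0 : E), Q.repα (Q.β g) (X (Q.β g))) := by
    refine (mfderiv_comp_apply _ hΘd (mdifferentiableAt_const.prodMk mdifferentiableAt_id)
      _).trans ?_
    rw [mfderiv_prod_right]
    rfl
  have hΘg : Θ (g, Q.ε (Q.β g)) = g := by
    have h1 := hg.self_of_nhds.2
    rw [Q.α_ε] at h1
    simp only [Θ, h1, leftTranslation, Q.α_ε, dite_true, Q.mul_unit]
  have hpair : ∀ (y : G) (v : E), y = g → (⟨g, v⟩ : TangentBundle 𝓘(ℝ, E) G) = ⟨y, v⟩ := by
    rintro y v rfl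
    rfl
  refine (hpair _ _ hΘg).trans (congrArg (fun v : E =>
    (⟨Θ (g, Q.ε (Q.β g)), v⟩ : TangentBundle 𝓘(ℝ, E) G)) ?_)
  rw [mfderivWithin_of_isOpen hΩ hgΩ]
  exact hval.trans hpartial

/-- At a unit, the left prolongation of `X` is the vertical representative of `X`, because the left
translation by a unit is the identity. -/
lemma leftProlongation_ε (X : ∀ a : M, Q.Normal a) (a : M) :
    (Q.leftProlongation X (Q.ε a) : E) = Q.repα a (X a) := by
  obtain ⟨P, W, hW, hP, hPα, hPid⟩ := (Q.α_submersion.isSubmersionOfComplement_complement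
    (Q.ε a)).exists_fibre_retraction
  have hval := Q.leftProlongation_eq_mfderiv hW hP hPα (g := Q.ε a) (by rwa [Q.β_ε]) X
  have hmem := hPid.self_of_nhds.1
  rw [Q.α_ε] at hmem
  have hPd : MDifferentiableAt (𝓘(ℝ, F).prod 𝓘(ℝ, E)) 𝓘(ℝ, E) P (a, Q.ε a) :=
    (hP.contMDiffAt (hW.mem_nhds hmem)).mdifferentiableAt (by simp)
  have hin : Continuous fun x : G => (a, x) := by fun_prop
  have hl : (fun x => Q.leftTranslation (Q.ε a) (P (a, x))) =ᶠ[𝓝 (Q.ε a)] fun x => P (a, x) := by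
    filter_upwards [(hW.preimage hin).mem_nhds hmem] with x hx
    have hα : Q.α (P (a, x)) = a := hPα _ hx
    have hu : ∀ (b : M) (h : G) (c : Q.β (Q.ε b) = Q.α h), b = Q.α h → Q.mul (Q.ε b) h c = h := by
      rintro _ h c rfl
      exact Q.unit_mul h
    have hc : Q.β (Q.ε a) = Q.α (P (a, x)) := by rw [Q.β_ε, hα]
    simp only [leftTranslation, dif_pos hc]
    exact hu _ _ _ hα.symm
  have hunit : ∀ b : M, b = a →
      (mfderiv 𝓘(ℝ, E) 𝓘(ℝ, E) (fun x => Q.leftTranslation (Q.ε a) (P (b, x))) (Q.ε b)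
        (Q.repα b (X b)) : E) = Q.repα a (X a) := by
    rintro b rfl
    rw [hl.mfderiv_eq]
    exact Q.mfderiv_retraction hPd (hPid.mono fun x hx => hx.2) (Q.tangentα_repα _ _)
  exact hval.trans (hunit _ (Q.β_ε a))

/-! ### The left algebroid bracket -/

lemma leftProlongation_add (X Y : ∀ a : M, Q.Normal a) :
    Q.leftProlongation (X + Y) = Q.leftProlongation X + Q.leftProlongation Y := by
  funext g
  simp only [leftProlongation, Pi.add_apply, map_add]
  rfl

lemma leftProlongation_smul (f : M → ℝ) (X : ∀ a : M, Q.Normal a) :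
    Q.leftProlongation (fun a => f a • X a) = (f ∘ Q.β) • Q.leftProlongation X := by
  funext g
  simp only [leftProlongation, Pi.smul_apply', map_smul, Function.comp]
  rfl

lemma mdifferentiableAt_leftProlongation (X : Q.Sections) (g : G) :
    MDifferentiableAt 𝓘(ℝ, E) (𝓘(ℝ, E).prod 𝓘(ℝ, E))
      (fun g => (⟨g, Q.leftProlongation X.1 g⟩ : TangentBundle 𝓘(ℝ, E) G)) g :=
  (Q.contMDiff_leftProlongation X.2).mdifferentiableAt (by simp)

lemma leftBracket_swap (X Y : ∀ a : M, Q.Normal a) (a : M) :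
    Q.leftBracket X Y a = -Q.leftBracket Y X a := by
  simp only [leftBracket]
  rw [VectorField.mlieBracket_swap_apply, Submodule.Quotient.mk_neg]

/-- The left bracket of smooth sections is represented, along all of `M`, by the restriction to `M`
of a smooth vector field on `G`. -/
lemma isSmoothSection_leftBracket [CompleteSpace E] (X Y : Q.Sections) :
    Q.IsSmoothSection (Q.leftBracket X.1 Y.1) := by
  intro a₀
  have : IsManifold 𝓘(ℝ, E) (minSmoothness ℝ 2) G := .of_le (n := ∞) (by
    simpa using (WithTop.coe_le_coe.2 (le_top : (2 : ℕ∞) ≤ ⊤)))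
  have : IsManifold 𝓘(ℝ, E) (((⊤ : ℕ∞) : WithTop ℕ∞) + 1) G := ‹IsManifold 𝓘(ℝ, E) ∞ G›
  have h := ContDiff.mlieBracket_vectorField (I := 𝓘(ℝ, E)) (m := ⊤) (n := ⊤)
    (Q.contMDiff_leftProlongation X.2) (Q.contMDiff_leftProlongation Y.2) (by simp)
  exact ⟨univ, univ_mem, fun a => VectorField.mlieBracket 𝓘(ℝ, E) (Q.leftProlongation X.1)
    (Q.leftProlongation Y.1) (Q.ε a), (h.comp Q.ε_smooth).contMDiffOn, fun _ _ => rfl⟩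

lemma leftBracket_add_right [CompleteSpace E] (X Y Z : Q.Sections) (a : M) :
    Q.leftBracket X.1 (Y + Z).1 a = Q.leftBracket X.1 Y.1 a + Q.leftBracket X.1 Z.1 a := by
  have h : Q.leftProlongation (Y + Z).1 = Q.leftProlongation Y.1 + Q.leftProlongation Z.1 :=
    Q.leftProlongation_add Y.1 Z.1
  simp only [leftBracket]
  rw [h, VectorField.mlieBracket_add_right (Q.mdifferentiableAt_leftProlongation Y _)
    (Q.mdifferentiableAt_leftProlongation Z _), Submodule.Quotient.mk_add]

/-- The Leibniz rule for the left bracket.  It is the Leibniz rule for the Lie bracket of vector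
fields on `G`, as `f X` prolongs to `(f ∘ β)` times the prolongation of `X`. -/
lemma leftBracket_smulSection_right [CompleteSpace E] (X Y : Q.Sections)
    (f : C^∞⟮𝓘(ℝ, F), M; 𝓘(ℝ, ℝ), ℝ⟯) (a : M) :
    Q.leftBracket X.1 (Q.smulSection f Y).1 a =
      mvfderiv 𝓘(ℝ, F) f a (Q.leftAnchor a (X.1 a)) • Y.1 a + f a • Q.leftBracket X.1 Y.1 a := by
  have hβ : MDifferentiableAt 𝓘(ℝ, E) 𝓘(ℝ, F) Q.β (Q.ε a) :=
    Q.β_submersion.contMDiff.mdifferentiableAt (by simp)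
  have hf : MDifferentiableAt 𝓘(ℝ, F) 𝓘(ℝ, ℝ) f a := f.contMDiff.mdifferentiableAt (by simp)
  have hfβ : MDifferentiableAt 𝓘(ℝ, E) 𝓘(ℝ, ℝ) (f ∘ Q.β) (Q.ε a) :=
    (f.contMDiff.comp Q.β_submersion.contMDiff).mdifferentiableAt (by simp)
  have h : Q.leftProlongation (Q.smulSection f Y).1 = (f ∘ Q.β) • Q.leftProlongation Y.1 :=
    Q.leftProlongation_smul f Y.1
  have hd : mvfderiv 𝓘(ℝ, E) (f ∘ Q.β) (Q.ε a) (Q.leftProlongation X.1 (Q.ε a)) =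
      mvfderiv 𝓘(ℝ, F) f a (Q.leftAnchor a (X.1 a)) := by
    refine (congrArg (fun v : E => mvfderiv 𝓘(ℝ, E) (f ∘ Q.β) (Q.ε a) v)
      (Q.leftProlongation_ε X.1 a)).trans ?_
    exact mfderiv_comp_apply_of_eq _ hf hβ (Q.β_ε a) _
  simp only [leftBracket]
  rw [h, VectorField.mlieBracket_smul_right hfβ (Q.mdifferentiableAt_leftProlongation Y _), hd,
    Submodule.Quotient.mk_add, Submodule.Quotient.mk_smul, Submodule.Quotient.mk_smul]
  congr 1
  · congr 1
    exact (congrArg (fun v : E => (Submodule.Quotient.mk v : Q.Normal a))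
      (Q.leftProlongation_ε Y.1 a)).trans (Q.mk_repα a _)
  · rw [Function.comp, Q.β_ε]

lemma leftBracket_smul_right [CompleteSpace E] (c : ℝ) (X Y : Q.Sections) (a : M) :
    Q.leftBracket X.1 (c • Y).1 a = c • Q.leftBracket X.1 Y.1 a := by
  have h : Q.leftProlongation (c • Y).1 = c • Q.leftProlongation Y.1 :=
    Q.leftProlongation_smul (fun _ => c) Y.1
  simp only [leftBracket]
  rw [h, VectorField.mlieBracket_const_smul_right (Q.mdifferentiableAt_leftProlongation Y _),
    Submodule.Quotient.mk_smul]

lemma contMDiff_leftAnchor (X : Q.Sections) :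
    ContMDiff 𝓘(ℝ, F) (𝓘(ℝ, F).prod 𝓘(ℝ, F)) ∞
      (fun a => (⟨a, Q.leftAnchor a (X.1 a)⟩ : TangentBundle 𝓘(ℝ, F) M)) := by
  have h := (Q.β_submersion.contMDiff.contMDiff_tangentMap (m := ∞) (by simp)).comp
    (contMDiffOn_univ.1 (Q.smoothAlong_repα X.2))
  refine h.congr fun a => ?_
  have hpair : ∀ (b : M) (v : F), b = a → (⟨a, v⟩ : TangentBundle 𝓘(ℝ, F) M) = ⟨b, v⟩ := by
    rintro b v rfl
    rfl
  exact hpair _ _ (Q.β_ε a)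

/-- The skew algebroid structure on `AG` defined by the left prolongations. -/
def leftSkewAlgebroid [CompleteSpace E] : Q.SkewAlgebroid where
  bracket := LinearMap.mk₂ ℝ
    (fun X Y => (⟨Q.leftBracket X.1 Y.1, Q.isSmoothSection_leftBracket X Y⟩ : Q.Sections))
    (fun X Y Z => Subtype.ext <| funext fun a => by
      change Q.leftBracket (X + Y).1 Z.1 a = Q.leftBracket X.1 Z.1 a + Q.leftBracket Y.1 Z.1 a
      rw [leftBracket_swap, leftBracket_add_right, neg_add, ← leftBracket_swap, ← leftBracket_swap])
    (fun c X Y => Subtype.ext <| funext fun a => by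
      change Q.leftBracket (c • X).1 Y.1 a = c • Q.leftBracket X.1 Y.1 a
      rw [leftBracket_swap, leftBracket_smul_right, ← smul_neg, ← leftBracket_swap])
    (fun X Y Z => Subtype.ext <| funext fun a => Q.leftBracket_add_right X Y Z a)
    (fun c X Y => Subtype.ext <| funext fun a => Q.leftBracket_smul_right c X Y a)
  anchor := Q.leftAnchor
  anchor_smooth := Q.contMDiff_leftAnchor
  skew X Y := Subtype.ext <| funext fun a => Q.leftBracket_swap X.1 Y.1 a
  leibniz := Q.leftBracket_smulSection_right

/-! ### The opposite quasiloopoid and the right bracket -/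

open Classical in
/-- The opposite quasiloopoid: `α` and `β` are exchanged, and the product of `g` and `h` is `h g`.
It has the same units, hence the same normal bundle and sections. -/
def opposite : SmoothQuasiloopoid E F G M where
  α := Q.β
  β := Q.α
  ε := Q.ε
  mul g h c := Q.mul h g c.symm
  α_surjective := Q.β_surjective
  β_surjective := Q.α_surjective
  α_submersion := Q.β_submersion
  β_submersion := Q.α_submersion
  ε_smooth := Q.ε_smooth
  α_ε := Q.β_ε
  β_ε := Q.α_ε
  mul_smooth := by
    have hswap : ContMDiffOn (𝓘(ℝ, E).prod 𝓘(ℝ, E)) (𝓘(ℝ, E).prod 𝓘(ℝ, E)) ∞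
        (Prod.swap : G × G → G × G) {p : G × G | Q.α p.1 = Q.β p.2} :=
      (contMDiff_snd.prodMk contMDiff_fst).contMDiffOn
    refine (Q.mul_smooth.comp hswap fun p hp => Eq.symm hp).congr fun p hp => ?_
    have hp : Q.α p.1 = Q.β p.2 := hp
    simp [hp]
  mul_unit := Q.unit_mul
  unit_mul := Q.mul_unit
  left_injective g h h' c c' := Q.right_injective g h h' c.symm c'.symm
  right_injective h g g' c c' := Q.left_injective h g g' c.symm c'.symm
  left_immersion g h c v hv hw := by
    refine Q.right_immersion g h c.symm v hv ?_
    have hfun : (fun k => if c : Q.β k = Q.α g then Q.mul k g c else g) =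
        fun k => if c : Q.α g = Q.β k then Q.mul k g c.symm else g :=
      funext fun k => dite_congr (propext eq_comm) (fun _ => rfl) fun _ => rfl
    rw [hfun]
    exact hw
  right_immersion h g c v hv hw := by
    refine Q.left_immersion h g c.symm v hv ?_
    have hfun : (fun k => if c : Q.β h = Q.α k then Q.mul h k c else h) =
        fun k => if c : Q.α k = Q.β h then Q.mul h k c.symm else h :=
      funext fun k => dite_congr (propext eq_comm) (fun _ => rfl) fun _ => rfl
    rw [hfun]
    exact hw

open Classical in
lemma leftTranslation_opposite (g : G) : Q.opposite.leftTranslation g = Q.rightTranslation g :=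
  funext fun _ => dite_congr (propext eq_comm) (fun _ => rfl) fun _ => rfl

lemma leftProlongation_opposite (X : ∀ a : M, Q.Normal a) :
    Q.opposite.leftProlongation X = Q.rightProlongation X := by
  funext h
  exact congrArg (fun l : G → G => (mfderivWithin 𝓘(ℝ, E) 𝓘(ℝ, E) l {g | Q.β g = Q.α h}
    (Q.ε (Q.α h)) (Q.repβ (Q.α h) (X (Q.α h))) : E)) (Q.leftTranslation_opposite h)

lemma leftBracket_opposite (X Y : ∀ a : M, Q.Normal a) (a : M) :
    Q.opposite.leftBracket X Y a = Q.rightBracket X Y a := by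
  simp only [leftBracket, rightBracket]
  rw [leftProlongation_opposite, leftProlongation_opposite]
  rfl

/-- A skew algebroid structure on the normal bundle of the opposite quasiloopoid is one on the
normal bundle of the quasiloopoid itself, as the two bundles coincide. -/
def SkewAlgebroid.ofOpposite (A : Q.opposite.SkewAlgebroid) : Q.SkewAlgebroid where
  bracket := A.bracket
  anchor := A.anchor
  anchor_smooth := A.anchor_smooth
  skew := A.skew
  leibniz := A.leibniz

lemma rightAnchor_eq_neg_leftAnchor (a : M) : Q.rightAnchor a = -Q.leftAnchor a := by
  refine LinearMap.ext fun x => ?_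
  obtain ⟨u, rfl⟩ := Submodule.Quotient.mk_surjective _ x
  change Q.tangentα a (u - Q.tangentε a (Q.tangentβ a u)) =
    -Q.tangentβ a (u - Q.tangentε a (Q.tangentα a u))
  rw [map_sub, map_sub, tangentα_tangentε, tangentβ_tangentε, neg_sub]

end SmoothQuasiloopoid

end

theorem mainTheorem2
    {E : Type*} [NormedAddCommGroup E] [NormedSpace ℝ E] [FiniteDimensional ℝ E]
    {F : Type*} [NormedAddCommGroup F] [NormedSpace ℝ F] [FiniteDimensional ℝ F]
    {G : Type*} [TopologicalSpace G] [ChartedSpace E G] [IsManifold 𝓘(ℝ, E) ∞ G]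
    [T2Space G] [SecondCountableTopology G]
    {M : Type*} [TopologicalSpace M] [ChartedSpace F M] [IsManifold 𝓘(ℝ, F) ∞ M]
    [T2Space M] [SecondCountableTopology M]
    (Q : SmoothQuasiloopoid E F G M) :
    (∀ X : Q.Sections,
      ContMDiff 𝓘(ℝ, E) (𝓘(ℝ, E).prod 𝓘(ℝ, E)) ∞
        (fun g => (⟨g, Q.leftProlongation X.1 g⟩ : TangentBundle 𝓘(ℝ, E) G)) ∧
      ContMDiff 𝓘(ℝ, E) (𝓘(ℝ, E).prod 𝓘(ℝ, E)) ∞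
        (fun g => (⟨g, Q.rightProlongation X.1 g⟩ : TangentBundle 𝓘(ℝ, E) G))) ∧
    (∃ A : Q.SkewAlgebroid,
      (∀ (X Y : Q.Sections) (a : M), (A.bracket X Y).1 a = Q.leftBracket X.1 Y.1 a) ∧
      (∀ a : M, A.anchor a = Q.leftAnchor a)) ∧
    (∃ A : Q.SkewAlgebroid,
      (∀ (X Y : Q.Sections) (a : M), (A.bracket X Y).1 a = Q.rightBracket X.1 Y.1 a) ∧
      (∀ a : M, A.anchor a = Q.rightAnchor a)) ∧
    (∀ a : M, Q.rightAnchor a = -Q.leftAnchor a) := by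
  have : CompleteSpace E := FiniteDimensional.complete ℝ E
  refine ⟨fun X => ⟨Q.contMDiff_leftProlongation X.2, ?_⟩,
    ⟨Q.leftSkewAlgebroid, fun X Y a => rfl, fun a => rfl⟩,
    ⟨SmoothQuasiloopoid.SkewAlgebroid.ofOpposite Q Q.opposite.leftSkewAlgebroid,
      fun X Y a => Q.leftBracket_opposite X.1 Y.1 a, fun a => rfl⟩,
    Q.rightAnchor_eq_neg_leftAnchor⟩
  rw [← Q.leftProlongation_opposite]
  exact Q.opposite.contMDiff_leftProlongation X.2
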